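/- Let $\mathbb{H}$ be the quaternions, $\mathbb{B}=\{q\in\mathbb{H}:|q|<1\}$ and $\mathbb{S}=\{I\in\mathbb{H}:I^2=-1\}$. A function $f:\mathbb{B}\to\mathbb{H}$ is slice regular if for every $I\in\mathbb{S}$ the map $(x,y)\mapsto f(x+yI)$ (for $x,y\in\mathbb{R}$, $x+yI\in\mathbb{B}$) is $C^1$ and satisfies $\frac12\big(\frac{\partial}{\partial x}+I\frac{\partial}{\partial y}\big)f(x+yI)=0$; its slice derivative is $f'(x+yI)=\frac12\big(\frac{\partial}{\partial x}-I\frac{\partial}{\partial y}\big)f(x+yI)$, and its coefficients are $a_n=f^{(n)}(0)/n!$. For slice regular functions on $\mathbb{B}$, $f(q)=\sum q^na_n$ and $g(q)=\sum q^nb_n$, put $f*g(q)=\sum_n q^n\sum_{k=0}^n a_kb_{n-k}$, $f^c(q)=\sum_n q^n\overline{a_n}$, $f^s=f*f^c$, $f^{-*}(q)=f^s(q)^{-1}f^c(q)$ where $f^s(q)\ne0$, and $f^{-*2}=f^{-*}*f^{-*}$. Let $\mathcal{S}^*$ be the class of slice regular functions $f$ on $\mathbb{B}$ whose zero set is $\{0\}$,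 with $f'(0)=1$ and $\operatorname{Re}\big(f(q)^{-1}qf'(q)\big)>0$ for all $q\in\mathbb{B}\setminus\{0\}$. **Theorem.** Let $f\in\mathcal{S}^*$, with coefficients $a_n$. Then $f(q)=q+\sum_{n=2}^{\infty}q^na_n$ for all $q\in\mathbb{B}$, and $$|a_n|\le n\qquad\text{for all } n=2,3,\ldots.$$ Moreover, for each given $n\ge2$, equality $|a_n|=n$ holds if and only if there is $u\in\mathbb{H}$ with $|u|=1$ such that $$f(q)=q(1-qu)^{-*2}\qquad\text{for all } q\in\mathbb{B}.$$ -/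

import Mathlib

open scoped Quaternion

noncomputable section

namespace SliceRegular

/-- The open unit ball of the quaternions. -/
def unitBall : Set ℍ := Metric.ball 0 1

/-- The sphere of imaginary units, `{I ∈ ℍ : I² = -1}`. -/
def imagUnits : Set ℍ := {I | I ^ 2 = -1}

/-- The point `x + y I` of the complex plane `ℝ + ℝ I`. -/
def slicePoint (I : ℍ) (x y : ℝ) : ℍ := (x : ℍ) + y • I

/-- `∂/∂x` of `(x, y) ↦ f (x + y I)`. -/
def partialX (f : ℍ → ℍ) (I : ℍ) (x y : ℝ) : ℍ := deriv (fun t : ℝ => f (slicePoint I t y)) x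

/-- `∂/∂y` of `(x, y) ↦ f (x + y I)`. -/
def partialY (f : ℍ → ℍ) (I : ℍ) (x y : ℝ) : ℍ := deriv (fun t : ℝ => f (slicePoint I x t)) y

/-- (Left) slice regularity of `f` on an open set `Ω`: for every imaginary unit `I`, the restriction
of `f` to the slice `Ω ∩ (ℝ + ℝ I)` is of class `C¹` and `(∂/∂x + I ∂/∂y) f (x + y I) / 2 = 0`. -/
def SliceRegularOn (f : ℍ → ℍ) (Ω : Set ℍ) : Prop :=
  ∀ I ∈ imagUnits,
    ContDiffOn ℝ 1 (fun p : ℝ × ℝ => f (slicePoint I p.1 p.2))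
        {p : ℝ × ℝ | slicePoint I p.1 p.2 ∈ Ω} ∧
      ∀ x y : ℝ, slicePoint I x y ∈ Ω →
        (1 / 2 : ℝ) • (partialX f I x y + I * partialY f I x y) = 0

/-- The `I`-derivative `(∂/∂x - I ∂/∂y) f (x + y I) / 2`. -/
def derivAlong (I : ℍ) (f : ℍ → ℍ) (x y : ℝ) : ℍ :=
  (1 / 2 : ℝ) • (partialX f I x y - I * partialY f I x y)

/-- The quaternion `i`. -/
def unitI : ℍ := ⟨0, 1, 0, 0⟩

open Classical in
/-- An imaginary unit `I` with `q ∈ ℝ + ℝ I`: it is `Im q / |Im q|` if `q` is not real, and the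
unit `i` (an arbitrary choice) if `q` is real. -/
def sliceUnit (q : ℍ) : ℍ := if q.im = 0 then unitI else ‖q.im‖⁻¹ • q.im

/-- The slice derivative `f'`: at `q = x + y I` it is the `I`-derivative of `f`. -/
def sliceDeriv (f : ℍ → ℍ) (q : ℍ) : ℍ := derivAlong (sliceUnit q) f q.re ‖q.im‖

/-- The power series coefficients `aₙ = f⁽ⁿ⁾(0) / n!` of `f` at the origin, with slice derivatives. -/
def coeff (f : ℍ → ℍ) (n : ℕ) : ℍ := ((n.factorial : ℝ)⁻¹) • (sliceDeriv^[n] f) 0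

/-- The regular product of `f = ∑ qⁿ aₙ` and `g = ∑ qⁿ bₙ`: `∑ qⁿ (∑_{k ≤ n} a_k b_{n-k})`. -/
def starMul (f g : ℍ → ℍ) (q : ℍ) : ℍ :=
  ∑' n : ℕ, q ^ n * ∑ k ∈ Finset.range (n + 1), coeff f k * coeff g (n - k)

/-- The regular conjugate `∑ qⁿ (conjugate of aₙ)` of `f = ∑ qⁿ aₙ`. -/
def regConj (f : ℍ → ℍ) (q : ℍ) : ℍ := ∑' n : ℕ, q ^ n * star (coeff f n)

/-- The symmetrization, the regular product of `f` with its regular conjugate. -/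
def symmetrization (f : ℍ → ℍ) : ℍ → ℍ := starMul f (regConj f)

/-- The regular reciprocal of `f` (meaningful off the zero set of the symmetrization). -/
def regRecip (f : ℍ → ℍ) (q : ℍ) : ℍ := (symmetrization f q)⁻¹ * regConj f q

/-- The class `𝒮`: slice regular on the unit ball, with zero set `{0}` and `f'(0) = 1`. -/
structure ClassS (f : ℍ → ℍ) : Prop where
  sliceRegular : SliceRegularOn f unitBall
  zeroSet : {q ∈ unitBall | f q = 0} = {0}
  deriv_zero : sliceDeriv f 0 = 1

/-- The class `𝒮*`: members of `𝒮` with `Re (f(q)⁻¹ q f'(q)) > 0` on the unit ball. At `q = 0`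
the expression has the form `0 / 0` (its limit is `1`), so the condition concerns `q ≠ 0`. -/
structure ClassSStar (f : ℍ → ℍ) : Prop where
  classS : ClassS f
  re_pos : ∀ q ∈ unitBall, q ≠ 0 → 0 < ((f q)⁻¹ * q * sliceDeriv f q).re

/-- The function `q ↦ q (1 - q u)^{-∗2}`, where `(1 - q u)^{-∗2}` is the regular product of the
regular reciprocal of `q ↦ 1 - q u` with itself. -/
def koebe (u : ℍ) (q : ℍ) : ℍ :=
  q * starMul (regRecip fun p => 1 - p * u) (regRecip fun p => 1 - p * u) q

end SliceRegular

end

/-! Write `f = q b`, so that `b` has no zeros on the ball and `b(0) = 1`, and let `p` be the formal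
regular quotient defined by `b * p = f'`. Comparing coefficients gives `n a_{n+1} = ∑_{i<n} a_{i+1}
p_{n-i}`. If `|p_k| ≤ 2` for `k ≥ 1`, induction gives `n |a_{n+1}| ≤ ∑_{i<n} 2(i+1) = n(n+1)`.

The bound on `p` is Carathéodory's, carried over to regular quotients
(`exists_hasSum_planePart_quotient`). With the real-coefficient series `s = b^c * b` one has `s * p
= b^c * f'`, and `s(q)⁻¹ (b^c * f')(q) = b(T)⁻¹ f'(T)` at the rotated point `T = b^c(q)⁻¹ q b^c(q)`.
The hypothesis at `T` makes the real part positive. Projecting to a plane `ℝ + ℝ I` yields a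
holomorphic function on the disc with positive real part, whose coefficients are the projections of
the `p_n`; choosing `I` with `p_n` in the plane loses nothing.

Equality for one `n` forces `|p_1| = 2`. The equality case of Schwarz's lemma then gives `p_n =
2uⁿ`, and the recursion yields `a_{n+1} = (n+1) uⁿ`, the coefficients of the Koebe function. -/

open scoped Topology

/-! ### Uniqueness of power series coefficients -/

/-- The formal series `∑ zⁿ cₙ`. -/
def formalSeriesOfCoeff (𝕜 : Type*) {E : Type*} [NontriviallyNormedField 𝕜]
    [NormedAddCommGroup E] [NormedSpace 𝕜 E] (c : ℕ → E) : FormalMultilinearSeries 𝕜 𝕜 E :=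
  fun n => ContinuousMultilinearMap.mkPiRing 𝕜 (Fin n) (c n)

@[simp]
theorem formalSeriesOfCoeff_coeff {𝕜 E : Type*} [NontriviallyNormedField 𝕜]
    [NormedAddCommGroup E] [NormedSpace 𝕜 E] (c : ℕ → E) (n : ℕ) :
    (formalSeriesOfCoeff 𝕜 c).coeff n = c n := by
  simp [formalSeriesOfCoeff, FormalMultilinearSeries.coeff]

theorem hasFPowerSeriesAt_of_hasSum {𝕜 E : Type*} [NontriviallyNormedField 𝕜]
    [NormedAddCommGroup E] [NormedSpace 𝕜 E] {c : ℕ → E} {F : 𝕜 → E}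
    (hF : ∀ x : 𝕜, ‖x‖ < 1 → HasSum (fun n => x ^ n • c n) (F x)) :
    HasFPowerSeriesAt F (formalSeriesOfCoeff 𝕜 c) 0 := by
  rw [hasFPowerSeriesAt_iff]
  filter_upwards [Metric.ball_mem_nhds (0 : 𝕜) one_pos] with x hx
  simpa using hF x (by simpa using hx)

/-- A power series expansion on `(-1, 1)` has uniquely determined coefficients. -/
theorem coeff_unique_of_hasSum {E : Type*} [NormedAddCommGroup E] [NormedSpace ℝ E]
    {a b : ℕ → E} {F : ℝ → E}
    (ha : ∀ x : ℝ, |x| < 1 → HasSum (fun n => x ^ n • a n) (F x))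
    (hb : ∀ x : ℝ, |x| < 1 → HasSum (fun n => x ^ n • b n) (F x)) : a = b := by
  have h := (hasFPowerSeriesAt_of_hasSum ha).eq_formalMultilinearSeries
    (hasFPowerSeriesAt_of_hasSum hb)
  funext n
  have h2 := congrArg (fun p : FormalMultilinearSeries ℝ ℝ E => p.coeff n) h
  simpa using h2

/-! ### Carathéodory's coefficient bound on the complex disc -/

namespace Complex

/-- A function which is the sum of a power series on the unit disc is holomorphic there. -/
theorem differentiableOn_of_hasSum {c : ℕ → ℂ} {F : ℂ → ℂ}
    (hF : ∀ z : ℂ, ‖z‖ < 1 → HasSum (fun n => z ^ n * c n) (F z)) :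
    DifferentiableOn ℂ F (Metric.ball 0 1) := by
  have h : HasFPowerSeriesOnBall F (formalSeriesOfCoeff ℂ c) 0 1 := by
    refine ⟨?_, one_pos, ?_⟩
    · refine ENNReal.le_of_forall_nnreal_lt fun r hr => ?_
      have hr1 : (r : ℝ) < 1 := by exact_mod_cast hr
      refine FormalMultilinearSeries.le_radius_of_tendsto _ (l := 0) ?_
      have h1 := (hF (r : ℂ) (by simpa using hr1)).summable.tendsto_atTop_zero.norm
      simpa [mul_comm, formalSeriesOfCoeff] using h1
    · intro y hy
      have hy1 : ‖y‖ < 1 := by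
        simpa [← enorm_eq_nnnorm, ← ofReal_norm, ENNReal.ofReal_lt_one] using hy
      simpa [formalSeriesOfCoeff] using hF y hy1
  have := h.differentiableOn
  rwa [← Metric.eball_ofReal, ENNReal.ofReal_one]

theorem hasSum_coeff_of_differentiableOn {F : ℂ → ℂ}
    (hF : DifferentiableOn ℂ F (Metric.ball 0 1)) :
    ∃ c : ℕ → ℂ, ∀ z : ℂ, ‖z‖ < 1 → HasSum (fun n => z ^ n * c n) (F z) := by
  refine ⟨fun n => (n.factorial : ℂ)⁻¹ * iteratedDeriv n F 0, fun z hz => ?_⟩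
  have h := Complex.hasSum_taylorSeries_on_ball (r := 1) hF (z := z) (by simpa using hz)
  simpa [mul_assoc, mul_comm, mul_left_comm] using h

theorem norm_sub_one_le_norm_add_one {w : ℂ} (hw : 0 ≤ w.re) : ‖w - 1‖ ≤ ‖w + 1‖ := by
  rw [← sq_le_sq₀ (norm_nonneg _) (norm_nonneg _), ← normSq_eq_norm_sq, ← normSq_eq_norm_sq,
    normSq_apply, normSq_apply]
  simp
  nlinarith

theorem coeff_zero_eq {c : ℕ → ℂ} {F : ℂ → ℂ}
    (hF : ∀ z : ℂ, ‖z‖ < 1 → HasSum (fun n => z ^ n * c n) (F z)) : F 0 = c 0 := by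
  refine (hF 0 (by simp)).unique ?_
  convert hasSum_single (f := fun n => (0 : ℂ) ^ n * c n) 0 ?_ using 1
  · simp
  · intro n hn
    simp [hn]

theorem hasDerivAt_zero_of_hasSum {c : ℕ → ℂ} {F : ℂ → ℂ}
    (hF : ∀ z : ℂ, ‖z‖ < 1 → HasSum (fun n => z ^ n * c n) (F z)) : HasDerivAt F (c 1) 0 := by
  have h := hasFPowerSeriesAt_of_hasSum (𝕜 := ℂ) (E := ℂ) (fun z hz => hF z hz)
  simpa using h.hasDerivAt

/-- The first coefficient of a function with positive real part, and the extremal functions. -/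
theorem norm_coeff_one_le_two {c : ℕ → ℂ} {F : ℂ → ℂ}
    (hF : ∀ z : ℂ, ‖z‖ < 1 → HasSum (fun n => z ^ n * c n) (F z)) (h0 : c 0 = 1)
    (hre : ∀ z : ℂ, ‖z‖ < 1 → 0 < (F z).re) :
    ‖c 1‖ ≤ 2 ∧ (‖c 1‖ = 2 → ∀ n, c (n + 1) = 2 * (c 1 / 2) ^ (n + 1)) := by
  have hd := differentiableOn_of_hasSum hF
  have hne : ∀ z ∈ Metric.ball (0 : ℂ) 1, F z + 1 ≠ 0 := by
    intro z hz h
    have := hre z (by simpa using hz)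
    have h2 := congrArg re h
    simp at h2
    linarith
  have hF0 : F 0 = 1 := by rw [coeff_zero_eq hF, h0]
  -- The Cayley transform sends the right half-plane into the unit disc, so Schwarz's lemma applies
  -- to `ω`, whose derivative at `0` is `c 1 / 2`.
  set ω : ℂ → ℂ := fun z => (F z - 1) / (F z + 1) with hω
  have hωd : DifferentiableOn ℂ ω (Metric.ball 0 1) :=
    (hd.sub_const 1).div (hd.add_const 1) hne
  have hω0 : ω 0 = 0 := by simp [hω, hF0]
  have hmaps : Set.MapsTo ω (Metric.ball 0 1) (Metric.closedBall (ω 0) 1) := by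
    intro z hz
    rw [hω0, mem_closedBall_zero_iff, hω, norm_div]
    refine div_le_one_of_le₀ (norm_sub_one_le_norm_add_one (hre z (by simpa using hz)).le)
      (norm_nonneg _)
  have hderiv : deriv ω 0 = c 1 / 2 := by
    have h1 := hasDerivAt_zero_of_hasSum hF
    have h2 := (h1.sub_const 1).div (h1.add_const 1) (hne 0 (by simp))
    have h3 := h2.deriv
    simp only [hF0] at h3
    refine Eq.trans h3 ?_
    ring
  have hle : ‖c 1 / 2‖ ≤ 1 := hderiv ▸ norm_deriv_le_one_of_mapsTo_ball hωd hmaps one_pos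
  refine ⟨by simpa [div_le_one] using hle, fun heq => ?_⟩
  -- Equality in Schwarz's lemma: `ω z = z u`, hence `F z = 2 (1 - z u)⁻¹ - 1`.
  have haff := affine_of_mapsTo_ball_of_norm_dslope_eq_div hωd hmaps (z₀ := 0) (by simp)
    (by rw [dslope_same, hderiv]; simp [heq])
  set u := c 1 / 2 with hu
  have hu1 : ‖u‖ = 1 := by simp [hu, heq]
  have hsum : ∀ z : ℂ, ‖z‖ < 1 →
      HasSum (fun n => z ^ n * (if n = 0 then 1 else 2 * u ^ n)) (F z) := by
    intro z hz
    have hzb : z ∈ Metric.ball (0 : ℂ) 1 := by simpa using hz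
    have h1 := haff hzb
    simp only [hω0, dslope_same, hderiv, sub_zero, zero_add, smul_eq_mul] at h1
    simp only [hω] at h1
    rw [div_eq_iff (hne z hzb)] at h1
    have hzu : ‖z * u‖ < 1 := by simpa [hu1] using hz
    have hzu1 : 1 - z * u ≠ 0 := by
      intro h
      rw [sub_eq_zero] at h
      rw [← h] at hzu
      simp at hzu
    have hFz : F z = 2 * (1 - z * u)⁻¹ - 1 := by
      field_simp
      linear_combination h1
    have hg := (hasSum_geometric_of_norm_lt_one hzu).mul_left 2
    have hs := hasSum_ite_eq (0 : ℕ) (1 : ℂ)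
    rw [hFz]
    have e : (fun n => z ^ n * (if n = 0 then 1 else 2 * u ^ n)) =
        fun n => 2 * (z * u) ^ n - if n = 0 then 1 else 0 := by
      funext n
      split_ifs with h
      · simp [h]; norm_num
      · rw [mul_pow]; ring
    rw [e]
    exact hg.sub hs
  have heqc : c = fun n => if n = 0 then 1 else 2 * u ^ n :=
    coeff_unique_of_hasSum (F := fun x : ℝ => F x)
      (fun x hx => by simpa using hF x (by simpa using hx))
      (fun x hx => by
        have := hsum x (by simpa using hx)
        simpa only [← ofReal_pow, ← real_smul] using this)
  intro n
  conv_lhs => rw [heqc]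
  simp

/-- Averaging over the rotations by `m`-th roots of unity extracts every `m`-th coefficient. -/
theorem sum_rotations_hasSum {c : ℕ → ℂ} {F : ℂ → ℂ} {m : ℕ} (hm : 0 < m) {ζ : ℂ}
    (hζ : IsPrimitiveRoot ζ m)
    (hF : ∀ z : ℂ, ‖z‖ < 1 → HasSum (fun n => z ^ n * c n) (F z)) {z : ℂ} (hz : ‖z‖ < 1) :
    HasSum (fun k => (z ^ m) ^ k * c (m * k))
      ((m : ℂ)⁻¹ * ∑ j ∈ Finset.range m, F (ζ ^ j * z)) := by
  have hnorm : ‖ζ‖ = 1 := hζ.norm'_eq_one hm.ne'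
  have h1 : HasSum (fun n => (m : ℂ)⁻¹ * ∑ j ∈ Finset.range m, (ζ ^ j * z) ^ n * c n)
      ((m : ℂ)⁻¹ * ∑ j ∈ Finset.range m, F (ζ ^ j * z)) :=
    (hasSum_sum fun j _ => hF (ζ ^ j * z) (by simpa [hnorm] using hz)).mul_left _
  have hm0 : (m : ℂ) ≠ 0 := by exact_mod_cast hm.ne'
  have hinj : Function.Injective (fun k : ℕ => m * k) := fun a b h =>
    Nat.eq_of_mul_eq_mul_left hm h
  rw [← hinj.hasSum_iff] at h1
  · convert h1 using 2 with k
    have : ∀ j ∈ Finset.range m, (ζ ^ j * z) ^ (m * k) * c (m * k) =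
        (z ^ m) ^ k * c (m * k) := by
      intro j _
      rw [mul_pow, ← pow_mul, show j * (m * k) = m * (j * k) by ring, pow_mul, hζ.pow_eq_one,
        one_pow, one_mul, pow_mul]
    simp only [Function.comp]
    rw [Finset.sum_congr rfl this]
    simp
    field_simp
  · intro n hn
    have hdvd : ¬ m ∣ n := fun ⟨k, hk⟩ => hn ⟨k, hk.symm⟩
    have hne : ζ ^ n ≠ 1 := fun h => hdvd ((hζ.pow_eq_one_iff_dvd n).1 h)
    have : ∑ j ∈ Finset.range m, (ζ ^ j * z) ^ n * c n =
        (∑ j ∈ Finset.range m, (ζ ^ n) ^ j) * (z ^ n * c n) := by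
      rw [Finset.sum_mul]
      refine Finset.sum_congr rfl fun j _ => ?_
      rw [mul_pow, ← pow_mul, ← pow_mul, mul_comm j n]; ring
    rw [this, geom_sum_eq hne, ← pow_mul, mul_comm n m, pow_mul, hζ.pow_eq_one]
    simp

/-- **Carathéodory's coefficient bound** for holomorphic functions with positive real part. -/
theorem norm_coeff_le_two {c : ℕ → ℂ} {F : ℂ → ℂ}
    (hF : ∀ z : ℂ, ‖z‖ < 1 → HasSum (fun n => z ^ n * c n) (F z)) (h0 : c 0 = 1)
    (hre : ∀ z : ℂ, ‖z‖ < 1 → 0 < (F z).re) (m : ℕ) (hm : 0 < m) : ‖c m‖ ≤ 2 := by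
  have hζ := isPrimitiveRoot_exp m hm.ne'
  set ζ := exp (2 * Real.pi * I / m)
  have hnorm : ‖ζ‖ = 1 := hζ.norm'_eq_one hm.ne'
  have hroot : ∀ w : ℂ, ‖w‖ < 1 → ∃ z : ℂ, ‖z‖ < 1 ∧ z ^ m = w := by
    intro w hw
    obtain ⟨z, hz⟩ := IsAlgClosed.exists_pow_nat_eq w hm
    refine ⟨z, ?_, hz⟩
    rw [← hz, norm_pow] at hw
    exact (pow_lt_one_iff_of_nonneg (norm_nonneg z) hm.ne').1 hw
  -- The root is chosen without any regularity: the averaged function is the sum of a power series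
  -- in `w = (r w) ^ m`, so its value does not depend on the choice.
  choose! r hr1 hr2 using hroot
  have h := norm_coeff_one_le_two (c := fun k => c (m * k))
    (F := fun w => (m : ℂ)⁻¹ * ∑ j ∈ Finset.range m, F (ζ ^ j * r w))
    (fun w hw => by simpa only [hr2 w hw] using sum_rotations_hasSum hm hζ hF (hr1 w hw))
    (by simpa using h0) (fun w hw => by
      have : (m : ℂ)⁻¹ = ((m : ℝ)⁻¹ : ℝ) := by simp
      rw [this, re_ofReal_mul, re_sum]
      refine mul_pos (by positivity) (Finset.sum_pos (fun j _ => hre _ ?_) ⟨0, by simpa using hm⟩)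
      simpa [hnorm] using hr1 w hw)
  simpa using h.1

end Complex

noncomputable section

namespace SliceRegular

variable {I : ℍ}

/-! ### Slices and the projection onto a slice -/

theorem imagUnits_components (hI : I ∈ imagUnits) :
    I.re = 0 ∧ I.imI ^ 2 + I.imJ ^ 2 + I.imK ^ 2 = 1 := by
  have h : I * I = -1 := by simpa [imagUnits, sq] using hI
  have h0 := congrArg (fun q : ℍ => q.re) h
  have h1 := congrArg (fun q : ℍ => q.imI) h
  have h2 := congrArg (fun q : ℍ => q.imJ) h
  have h3 := congrArg (fun q : ℍ => q.imK) h
  simp only [Quaternion.re_mul, Quaternion.imI_mul, Quaternion.imJ_mul, Quaternion.imK_mul,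
    Quaternion.re_neg, Quaternion.imI_neg, Quaternion.imJ_neg, Quaternion.imK_neg,
    Quaternion.re_one, Quaternion.imI_one, Quaternion.imJ_one, Quaternion.imK_one] at h0 h1 h2 h3
  have hre : I.re = 0 := by
    by_contra hne
    have e1 : I.imI = 0 := by
      have : I.re * I.imI = 0 := by linarith
      simpa [hne] using this
    have e2 : I.imJ = 0 := by
      have : I.re * I.imJ = 0 := by linarith
      simpa [hne] using this
    have e3 : I.imK = 0 := by
      have : I.re * I.imK = 0 := by linarith
      simpa [hne] using this
    rw [e1, e2, e3] at h0
    nlinarith [sq_nonneg I.re]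
  refine ⟨hre, ?_⟩
  rw [hre] at h0
  linarith

theorem mem_imagUnits_of_components {J : ℍ} (h0 : J.re = 0)
    (h1 : J.imI ^ 2 + J.imJ ^ 2 + J.imK ^ 2 = 1) : J ∈ imagUnits := by
  change J ^ 2 = -1
  rw [sq]
  ext <;> simp [h0] <;> linarith

theorem imagUnits_mul_self (hI : I ∈ imagUnits) : I * I = -1 := by
  simpa [imagUnits, sq] using hI

/-- The embedding `x + y i ↦ x + y I` of the complex numbers. -/
def embed (hI : I ∈ imagUnits) : ℂ →ₐ[ℝ] ℍ := Complex.liftAux I (imagUnits_mul_self hI)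

theorem embed_apply (hI : I ∈ imagUnits) (z : ℂ) : embed hI z = slicePoint I z.re z.im := by
  simp [embed, slicePoint, Complex.liftAux_apply]

theorem embed_mk (hI : I ∈ imagUnits) (x y : ℝ) : embed hI ⟨x, y⟩ = slicePoint I x y :=
  embed_apply hI _

@[simp]
theorem embed_I (hI : I ∈ imagUnits) : embed hI Complex.I = I := by
  simp [embed]

@[simp]
theorem embed_ofReal (hI : I ∈ imagUnits) (x : ℝ) : embed hI (x : ℂ) = (x : ℍ) :=
  (embed hI).commutes x

@[simp]
theorem norm_embed (hI : I ∈ imagUnits) (z : ℂ) : ‖embed hI z‖ = ‖z‖ := by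
  obtain ⟨h0, h1⟩ := imagUnits_components hI
  rw [← sq_eq_sq₀ (norm_nonneg _) (norm_nonneg _), ← Complex.normSq_eq_norm_sq, sq,
    ← Quaternion.normSq_eq_norm_mul_self, Quaternion.normSq_def', embed_apply,
    Complex.normSq_apply]
  simp [slicePoint, h0]
  linear_combination z.im ^ 2 * h1

theorem continuous_embed (hI : I ∈ imagUnits) : Continuous (embed hI) :=
  (embed hI).toLinearMap.continuous_of_finiteDimensional

/-- The component in the plane `ℝ + ℝ I` of a quaternion, as a complex number. -/
def planePart (I : ℍ) : ℍ →L[ℝ] ℂ :=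
  LinearMap.toContinuousLinearMap
    { toFun := fun w => ⟨w.re, -(w * I).re⟩
      map_add' := fun v w => by
        apply Complex.ext
        · simp
        · simp; ring
      map_smul' := fun r w => by
        apply Complex.ext
        · simp
        · simp; ring }

theorem planePart_apply (I w : ℍ) : planePart I w = ⟨w.re, -(w * I).re⟩ := rfl

@[simp]
theorem planePart_re (I w : ℍ) : (planePart I w).re = w.re := rfl

/-- The projection is linear over the slice acting on the left. Since coefficients stand on the
right of powers, it turns a quaternionic series on the slice into a complex power series. -/
theorem planePart_embed_mul (hI : I ∈ imagUnits) (z : ℂ) (w : ℍ) :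
    planePart I (embed hI z * w) = z * planePart I w := by
  obtain ⟨h0, h1⟩ := imagUnits_components hI
  rw [planePart_apply, planePart_apply, embed_apply]
  apply Complex.ext
  · simp [slicePoint, h0]
    ring
  · simp [slicePoint, h0]
    linear_combination z.im * w.re * h1

theorem planePart_embed (hI : I ∈ imagUnits) (z : ℂ) : planePart I (embed hI z) = z := by
  have h := planePart_embed_mul hI z 1
  rw [mul_one] at h
  rw [h, planePart_apply]
  obtain ⟨h0, -⟩ := imagUnits_components hI
  apply Complex.ext <;> simp [h0]

/-- Pythagoras: `planePart I` is the orthogonal projection onto the plane of `I`, because `-(w *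
I).re` is the inner product of `w` with `I`. -/
theorem norm_sq_eq_planePart (hI : I ∈ imagUnits) (w : ℍ) :
    ‖w‖ ^ 2 = ‖planePart I w‖ ^ 2 + ‖w - embed hI (planePart I w)‖ ^ 2 := by
  obtain ⟨h0, h1⟩ := imagUnits_components hI
  rw [← Complex.normSq_eq_norm_sq, sq, sq, ← Quaternion.normSq_eq_norm_mul_self,
    ← Quaternion.normSq_eq_norm_mul_self, Quaternion.normSq_def', Quaternion.normSq_def',
    embed_apply, Complex.normSq_apply, planePart_apply]
  simp [slicePoint, h0]
  linear_combination (-(w.imI * I.imI + w.imJ * I.imJ + w.imK * I.imK) ^ 2) * h1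

theorem eq_embed_of_norm_planePart (hI : I ∈ imagUnits) {w : ℍ} (h : ‖w‖ ≤ ‖planePart I w‖) :
    w = embed hI (planePart I w) := by
  have h1 := norm_sq_eq_planePart hI w
  have h2 : ‖w‖ ^ 2 ≤ ‖planePart I w‖ ^ 2 := by gcongr
  have h3 : ‖w - embed hI (planePart I w)‖ ^ 2 = 0 :=
    le_antisymm (by linarith) (sq_nonneg _)
  exact sub_eq_zero.1 (norm_eq_zero.1 (pow_eq_zero_iff two_ne_zero |>.1 h3))

theorem sliceUnit_mem (q : ℍ) : sliceUnit q ∈ imagUnits := by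
  unfold sliceUnit
  split_ifs with h
  · exact mem_imagUnits_of_components rfl (by simp [unitI])
  · have hne : ‖q.im‖ ≠ 0 := norm_ne_zero_iff.2 h
    have hn : ‖q.im‖ ^ 2 = q.imI ^ 2 + q.imJ ^ 2 + q.imK ^ 2 := by
      rw [sq, ← Quaternion.normSq_eq_norm_mul_self, Quaternion.normSq_def']
      simp
    refine mem_imagUnits_of_components (by simp) ?_
    simp
    field_simp
    linarith

theorem slicePoint_sliceUnit (q : ℍ) : slicePoint (sliceUnit q) q.re ‖q.im‖ = q := by
  unfold sliceUnit slicePoint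
  split_ifs with h
  · rw [h]
    simp
    conv_rhs => rw [← Quaternion.re_add_im q, h]
    simp
  · have hne : ‖q.im‖ ≠ 0 := norm_ne_zero_iff.2 h
    rw [smul_smul, mul_inv_cancel₀ hne, one_smul, Quaternion.re_add_im]

theorem exists_embed_eq (q : ℍ) : ∃ (I : ℍ) (hI : I ∈ imagUnits) (z : ℂ), embed hI z = q :=
  ⟨sliceUnit q, sliceUnit_mem q, ⟨q.re, ‖q.im‖⟩, by
    rw [embed_mk, slicePoint_sliceUnit]⟩

/-! ### Expansions on the ball -/

/-- `f` is the sum of `∑ qⁿ aₙ` on the unit ball. -/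
def HasExpansion (f : ℍ → ℍ) (a : ℕ → ℍ) : Prop :=
  ∀ q : ℍ, ‖q‖ < 1 → HasSum (fun n => q ^ n * a n) (f q)

/-- `∑ qⁿ aₙ` converges absolutely on the unit ball. -/
def ConvergesOnBall (a : ℕ → ℍ) : Prop :=
  ∀ r : ℝ, 0 ≤ r → r < 1 → Summable fun n => r ^ n * ‖a n‖

variable {f g : ℍ → ℍ} {a b : ℕ → ℍ}

theorem HasExpansion.unique (hf : HasExpansion f a) (hg : HasExpansion f b) : a = b := by
  have key : ∀ c, HasExpansion f c → ∀ x : ℝ, |x| < 1 →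
      HasSum (fun n => x ^ n • c n) (f (x : ℍ)) := by
    intro c hc x hx
    have h := hc (x : ℍ) (by simpa using hx)
    simpa [← Quaternion.coe_pow, Quaternion.coe_mul_eq_smul] using h
  exact coeff_unique_of_hasSum (F := fun x : ℝ => f (x : ℍ)) (key a hf) (key b hg)

theorem HasExpansion.exists_bound (hf : HasExpansion f a) {r : ℝ} (h0 : 0 ≤ r) (h1 : r < 1) :
    ∃ C : ℝ, ∀ n, ‖a n‖ * r ^ n ≤ C := by
  have h := (hf (r : ℍ) (by simpa [abs_of_nonneg h0] using h1)).summable.tendsto_atTop_zero.norm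
  obtain ⟨C, hC⟩ := h.bddAbove_range
  refine ⟨C, fun n => ?_⟩
  have := hC ⟨n, rfl⟩
  simpa [abs_of_nonneg h0, mul_comm] using this

theorem summable_succ_mul_geometric {r : ℝ} (h0 : 0 ≤ r) (h1 : r < 1) :
    Summable fun n : ℕ => ((n : ℝ) + 1) * r ^ n := by
  have ht : ‖r‖ < 1 := by rwa [Real.norm_of_nonneg h0]
  have := (summable_pow_mul_geometric_of_norm_lt_one 1 ht).add
    (summable_geometric_of_norm_lt_one ht)
  refine this.congr fun n => ?_
  ring

theorem HasExpansion.summable_mul (hf : HasExpansion f a) {r : ℝ} (h0 : 0 ≤ r) (h1 : r < 1) :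
    Summable fun n : ℕ => ((n : ℝ) + 1) * r ^ n * ‖a n‖ := by
  obtain ⟨s, hrs, hs1⟩ := exists_between h1
  have hs0 : 0 < s := h0.trans_lt hrs
  obtain ⟨C, hC⟩ := hf.exists_bound hs0.le hs1
  have hsum := summable_succ_mul_geometric (div_nonneg h0 hs0.le) ((div_lt_one hs0).2 hrs)
  -- Boundedness of `‖a n‖ * s ^ n` at the larger radius `s` leaves the ratio `r / s < 1` to absorb
  -- the factor `n + 1`.
  refine Summable.of_nonneg_of_le (fun n => by positivity) (fun n => ?_) (hsum.mul_right C)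
  rw [div_pow]
  calc ((n : ℝ) + 1) * r ^ n * ‖a n‖ = ((n : ℝ) + 1) * (r ^ n / s ^ n) * (‖a n‖ * s ^ n) := by
        field_simp
    _ ≤ _ := mul_le_mul_of_nonneg_left (hC n) (by positivity)

theorem HasExpansion.convergesOnBall (hf : HasExpansion f a) : ConvergesOnBall a := by
  intro r h0 h1
  refine Summable.of_nonneg_of_le (fun n => by positivity) (fun n => ?_) (hf.summable_mul h0 h1)
  have : 0 ≤ (n : ℝ) * (r ^ n * ‖a n‖) := by positivity
  nlinarith

theorem ConvergesOnBall.summable_norm (ha : ConvergesOnBall a) {q : ℍ} (hq : ‖q‖ < 1) :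
    Summable fun n => ‖q ^ n * a n‖ := by
  simpa using ha ‖q‖ (norm_nonneg q) hq

theorem ConvergesOnBall.hasSum (ha : ConvergesOnBall a) {q : ℍ} (hq : ‖q‖ < 1) :
    HasSum (fun n => q ^ n * a n) (∑' n, q ^ n * a n) :=
  (ha.summable_norm hq).of_norm.hasSum

theorem ConvergesOnBall.hasExpansion (ha : ConvergesOnBall a) :
    HasExpansion (fun q => ∑' n, q ^ n * a n) a := fun _ hq => ha.hasSum hq

theorem HasExpansion.zero (hf : HasExpansion f a) : f 0 = a 0 := by
  refine (hf 0 (by simp)).unique ?_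
  convert hasSum_single (f := fun n => (0 : ℍ) ^ n * a n) 0 ?_ using 1
  · simp
  · intro n hn
    simp [hn]

/-- Termwise differentiation along a line in a slice. -/
theorem HasExpansion.hasDerivAt (hf : HasExpansion f a) (hI : I ∈ imagUnits) {z : ℂ}
    (hz : ‖z‖ < 1) (v : ℂ) :
    HasDerivAt (fun t : ℝ => f (embed hI (z + t * v)))
      (∑' n : ℕ, embed hI ((n : ℂ) * z ^ (n - 1) * v) * a n) 0 := by
  obtain ⟨r, hzr, hr1⟩ := exists_between hz
  have hr0 : 0 < r := (norm_nonneg z).trans_lt hzr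
  have hcont : Continuous fun t : ℝ => z + t * v := by fun_prop
  have hopen : IsOpen {t : ℝ | ‖z + t * v‖ < r} := isOpen_lt hcont.norm continuous_const
  obtain ⟨ε, hε, hball⟩ := Metric.isOpen_iff.1 hopen 0 (by simpa using hzr)
  have h0 : (0 : ℝ) ∈ Metric.ball (0 : ℝ) ε := Metric.mem_ball_self hε
  have hterm : ∀ (n : ℕ) (t : ℝ), HasDerivAt (fun t : ℝ => embed hI ((z + t * v) ^ n) * a n)
      (embed hI ((n : ℂ) * (z + t * v) ^ (n - 1) * v) * a n) t := by
    intro n t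
    have h1 : HasDerivAt (fun t : ℝ => z + (t : ℂ) * v) v t := by
      simpa using ((Complex.ofRealCLM.hasDerivAt (x := t)).mul_const v).const_add z
    have h2 := h1.pow n
    have h3 := ((embed hI).toLinearMap.toContinuousLinearMap.hasFDerivAt.comp_hasDerivAt t h2)
    exact h3.mul_const (a n)
  -- The majorant carries `r ^ n`, while the differentiated terms carry `r ^ (n - 1)`; dividing by
  -- `r` compensates.
  have hsum := (hf.summable_mul hr0.le hr1).mul_right (‖v‖ / r)
  have key := hasDerivAt_tsum_of_isPreconnected hsum Metric.isOpen_ball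
    (convex_ball (0 : ℝ) ε).isPreconnected (fun n t _ => hterm n t) (fun n t ht => ?_) h0
    (y := 0) ?_ h0
  · simp only [Complex.ofReal_zero, zero_mul, add_zero] at key
    refine key.congr_of_eventuallyEq ?_
    filter_upwards [Metric.ball_mem_nhds 0 hε] with t ht
    have hlt : ‖embed hI (z + t * v)‖ < 1 := by
      rw [norm_embed]
      exact (hball ht).trans hr1
    have := (hf _ hlt).tsum_eq
    simpa using this.symm
  · have hlt : ‖z + t * v‖ ≤ r := (hball ht).le
    rw [norm_mul, norm_embed, norm_mul, norm_mul, norm_pow]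
    rcases n with _ | n
    · simp; positivity
    · have hp : ‖z + t * v‖ ^ n ≤ r ^ n := by gcongr
      have hn : ‖((n + 1 : ℕ) : ℂ)‖ = (n : ℝ) + 1 := by
        rw [Complex.norm_natCast]; push_cast; ring
      rw [hn, Nat.add_sub_cancel]
      calc ((n : ℝ) + 1) * ‖z + t * v‖ ^ n * ‖v‖ * ‖a (n + 1)‖
          ≤ ((n : ℝ) + 2) * r ^ n * ‖v‖ * ‖a (n + 1)‖ := by gcongr; norm_num
        _ = _ := by push_cast; field_simp; ring
  · have := hf (embed hI z) (by simpa using hz)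
    simpa using this.summable

theorem hasDerivAt_comp_slice_left {x y : ℝ} (hI : I ∈ imagUnits) {D : ℍ}
    (h : HasDerivAt (fun t : ℝ => f (embed hI (⟨x, y⟩ + t * 1))) D 0) : partialX f I x y = D := by
  have h1 : HasDerivAt (fun t : ℝ => f (slicePoint I t y)) D x := by
    have h2 := (HasDerivAt.comp_sub_const (x := x) (a := x) (f := fun t : ℝ =>
      f (embed hI (⟨x, y⟩ + t * 1))) (by simpa using h))
    refine h2.congr_of_eventuallyEq (Filter.Eventually.of_forall fun t => ?_)
    beta_reduce
    rw [← embed_mk hI]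
    congr 2
    apply Complex.ext <;> simp
  exact h1.deriv

theorem hasDerivAt_comp_slice_right {x y : ℝ} (hI : I ∈ imagUnits) {D : ℍ}
    (h : HasDerivAt (fun t : ℝ => f (embed hI (⟨x, y⟩ + t * Complex.I))) D 0) :
    partialY f I x y = D := by
  have h1 : HasDerivAt (fun t : ℝ => f (slicePoint I x t)) D y := by
    have h2 := (HasDerivAt.comp_sub_const (x := y) (a := y) (f := fun t : ℝ =>
      f (embed hI (⟨x, y⟩ + t * Complex.I))) (by simpa using h))
    refine h2.congr_of_eventuallyEq (Filter.Eventually.of_forall fun t => ?_)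
    beta_reduce
    rw [← embed_mk hI]
    congr 2
    apply Complex.ext <;> simp
  exact h1.deriv

theorem HasExpansion.summable_deriv (hf : HasExpansion f a) {q : ℍ} (hq : ‖q‖ < 1) :
    Summable fun n : ℕ => q ^ (n - 1) * (n : ℍ) * a n := by
  rcases eq_or_ne q 0 with rfl | hne
  · refine summable_of_ne_finset_zero (s := {0, 1}) fun n hn => ?_
    have : n - 1 ≠ 0 := by simp at hn; omega
    simp [this]
  · have hq0 : 0 < ‖q‖ := norm_pos_iff.2 hne
    refine Summable.of_norm_bounded ((hf.summable_mul hq0.le hq).mul_right ‖q‖⁻¹) fun n => ?_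
    rcases n with _ | n
    · simp; positivity
    · have hn : ‖((n + 1 : ℕ) : ℍ)‖ = (n : ℝ) + 1 := by
        rw [← Quaternion.coe_natCast, Quaternion.norm_coe, Real.norm_natCast]
        push_cast; ring
      rw [norm_mul, norm_mul, norm_pow, hn, Nat.add_sub_cancel]
      calc ‖q‖ ^ n * ((n : ℝ) + 1) * ‖a (n + 1)‖
          ≤ ‖q‖ ^ n * ((n : ℝ) + 2) * ‖a (n + 1)‖ := by gcongr; norm_num
        _ = _ := by push_cast; field_simp; ring

/-- The slice derivative is computed termwise. -/
theorem HasExpansion.sliceDeriv (hf : HasExpansion f a) :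
    HasExpansion (sliceDeriv f) fun n => ((n : ℍ) + 1) * a (n + 1) := by
  intro q hq
  set hI := sliceUnit_mem q
  set z : ℂ := ⟨q.re, ‖q.im‖⟩
  have hzq : embed hI z = q := by rw [embed_mk, slicePoint_sliceUnit]
  have hz : ‖z‖ < 1 := by rwa [← norm_embed hI, hzq]
  have hX := hasDerivAt_comp_slice_left hI (hf.hasDerivAt hI hz 1)
  have hY := hasDerivAt_comp_slice_right hI (hf.hasDerivAt hI hz Complex.I)
  have hs := hf.summable_deriv hq
  have eX : ∀ n : ℕ, embed hI ((n : ℂ) * z ^ (n - 1) * 1) * a n = q ^ (n - 1) * (n : ℍ) * a n := by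
    intro n
    rw [mul_one, mul_comm (n : ℂ), map_mul, map_pow, hzq, map_natCast]
  have eY : ∀ n : ℕ, embed hI ((n : ℂ) * z ^ (n - 1) * Complex.I) * a n =
      sliceUnit q * (q ^ (n - 1) * (n : ℍ) * a n) := by
    intro n
    rw [mul_comm, ← eX, mul_one, map_mul, embed_I, mul_assoc]
  simp only [eX] at hX
  simp only [eY] at hY
  rw [hs.tsum_mul_left] at hY
  have hval : SliceRegular.sliceDeriv f q = ∑' n : ℕ, q ^ (n - 1) * (n : ℍ) * a n := by
    rw [SliceRegular.sliceDeriv, derivAlong, hX, hY, ← mul_assoc, imagUnits_mul_self hI,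
      neg_one_mul, sub_neg_eq_add, ← two_smul ℝ, smul_smul]
    norm_num
  have h := hs.hasSum
  rw [← hval, ← hasSum_nat_add_iff' 1] at h
  simpa [mul_assoc] using h

theorem HasExpansion.iterate_sliceDeriv (hf : HasExpansion f a) (k : ℕ) :
    HasExpansion (SliceRegular.sliceDeriv^[k] f)
      fun n => (((n + k).descFactorial k : ℕ) : ℍ) * a (n + k) := by
  induction k with
  | zero => simpa using hf
  | succ k ih =>
    rw [Function.iterate_succ_apply']
    convert ih.sliceDeriv using 2 with n
    rw [← mul_assoc, show n + 1 + k = n + (k + 1) by ring]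
    congr 1
    rw [Nat.descFactorial_succ, show n + (k + 1) - k = n + 1 by omega]
    push_cast
    rfl

theorem HasExpansion.coeff_eq (hf : HasExpansion f a) : coeff f = a := by
  funext n
  have h := (hf.iterate_sliceDeriv n).zero
  rw [coeff, h, zero_add, Nat.descFactorial_self, ← Quaternion.coe_natCast,
    Quaternion.coe_mul_eq_smul, smul_smul, inv_mul_cancel₀ (by positivity), one_smul]


/-! ### Slice regular functions are power series -/

/-- A function which is holomorphic for the complex structure given by left multiplication by `I`
has a power series expansion. -/
theorem exists_hasSum_of_isLittleO (hI : I ∈ imagUnits) {G : ℂ → ℍ}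
    (hG : ∀ z : ℂ, ‖z‖ < 1 → ∃ X : ℍ,
      (fun w => G w - G z - embed hI (w - z) * X) =o[𝓝 z] fun w => w - z) :
    ∃ c : ℕ → ℍ, ∀ z : ℂ, ‖z‖ < 1 → HasSum (fun n => embed hI (z ^ n) * c n) (G z) := by
  -- Left multiplication through `embed hI` makes `ℍ` a complex normed space, so the Taylor theorem
  -- for vector-valued holomorphic functions applies.
  let _ : Module ℂ ℍ := Module.compHom ℍ (embed hI).toRingHom
  have hsmul : ∀ (z : ℂ) (w : ℍ), z • w = embed hI z * w := fun _ _ => rfl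
  let _ : NormedSpace ℂ ℍ := ⟨fun z w => by rw [hsmul, norm_mul, norm_embed]⟩
  have hd : DifferentiableOn ℂ G (Metric.ball 0 1) := by
    intro z hz
    obtain ⟨X, hX⟩ := hG z (by simpa using hz)
    have : HasDerivAt G X z := by
      rw [hasDerivAt_iff_isLittleO]
      exact hX
    exact this.differentiableAt.differentiableWithinAt
  refine ⟨fun n => (n.factorial : ℂ)⁻¹ • iteratedDeriv n G 0, fun z hz => ?_⟩
  have h := Complex.hasSum_taylorSeries_on_ball (r := 1) hd (z := z) (by simpa using hz)
  have e : ∀ n : ℕ, embed hI (z ^ n) * ((n.factorial : ℂ)⁻¹ • iteratedDeriv n G 0) =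
      (n.factorial : ℂ)⁻¹ • (z - 0) ^ n • iteratedDeriv n G 0 := by
    intro n
    rw [sub_zero, ← hsmul, smul_comm]
  simp only [e]
  exact h

/-- The Cauchy–Riemann equation says `L (0, 1) = I * L (1, 0)` for the real differential `L`, so `L`
is left multiplication of `X = L (1, 0)` by the increment in the slice. -/
theorem SliceRegularOn.isLittleO (hf : SliceRegularOn f unitBall) (hI : I ∈ imagUnits) {z : ℂ}
    (hz : ‖z‖ < 1) : ∃ X : ℍ,
      (fun w => f (embed hI w) - f (embed hI z) - embed hI (w - z) * X) =o[𝓝 z]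
        fun w => w - z := by
  obtain ⟨hC, hCR⟩ := hf I hI
  set F : ℝ × ℝ → ℍ := fun p => f (slicePoint I p.1 p.2)
  have hset : {p : ℝ × ℝ | slicePoint I p.1 p.2 ∈ unitBall} =
      {p : ℝ × ℝ | ‖embed hI (Complex.equivRealProdCLM.symm p)‖ < 1} := by
    ext p
    simp [unitBall, embed_apply]
  have hopen : IsOpen {p : ℝ × ℝ | slicePoint I p.1 p.2 ∈ unitBall} := by
    rw [hset]
    exact isOpen_lt (((continuous_embed hI).comp
      Complex.equivRealProdCLM.symm.continuous).norm) continuous_const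
  have hmem : (z.re, z.im) ∈ {p : ℝ × ℝ | slicePoint I p.1 p.2 ∈ unitBall} := by
    simpa [unitBall, ← embed_apply hI] using hz
  have hF : DifferentiableAt ℝ F (z.re, z.im) :=
    (hC.differentiableOn one_ne_zero).differentiableAt (hopen.mem_nhds hmem)
  set L := fderiv ℝ F (z.re, z.im)
  have hL : HasFDerivAt F L (z.re, z.im) := hF.hasFDerivAt
  have hX : partialX f I z.re z.im = L (1, 0) := by
    have h1 : HasDerivAt (fun t : ℝ => (t, z.im)) (1, 0) z.re :=
      (hasDerivAt_id z.re).prodMk (hasDerivAt_const z.re z.im)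
    exact (hL.comp_hasDerivAt z.re h1).deriv
  have hY : partialY f I z.re z.im = L (0, 1) := by
    have h1 : HasDerivAt (fun t : ℝ => (z.re, t)) (0, 1) z.im :=
      (hasDerivAt_const z.im z.re).prodMk (hasDerivAt_id z.im)
    exact (hL.comp_hasDerivAt z.im h1).deriv
  have hcr := hCR z.re z.im hmem
  rw [smul_eq_zero_iff_right (by norm_num), hX, hY] at hcr
  have hcr' : L (0, 1) = I * L (1, 0) := by
    have h1 : I * (L (1, 0) + I * L (0, 1)) = 0 := by rw [hcr, mul_zero]
    rw [mul_add, ← mul_assoc, imagUnits_mul_self hI, neg_one_mul, add_neg_eq_zero] at h1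
    exact h1.symm
  refine ⟨L (1, 0), ?_⟩
  have hcomp : HasFDerivAt (fun w : ℂ => f (embed hI w))
      (L.comp (Complex.equivRealProdCLM : ℂ →L[ℝ] ℝ × ℝ)) z := by
    have h1 : HasFDerivAt F L (Complex.equivRealProdCLM z) := hL
    have h2 := h1.comp z Complex.equivRealProdCLM.hasFDerivAt
    refine h2.congr_of_eventuallyEq (Filter.Eventually.of_forall fun w => ?_)
    simp [F, embed_apply]
  rw [hasFDerivAt_iff_isLittleO] at hcomp
  refine hcomp.congr_left fun w => ?_
  congr 1
  have : (Complex.equivRealProdCLM (w - z) : ℝ × ℝ) =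
      (w - z).re • ((1, 0) : ℝ × ℝ) + (w - z).im • ((0, 1) : ℝ × ℝ) := by
    ext <;> simp
  rw [ContinuousLinearMap.comp_apply, ContinuousLinearEquiv.coe_coe, this, map_add, map_smul,
    map_smul, hcr', embed_apply, slicePoint, add_mul, Quaternion.coe_mul_eq_smul, smul_mul_assoc]

/-- Slice regular functions on the ball are sums of power series. -/
theorem SliceRegularOn.exists_hasExpansion (hf : SliceRegularOn f unitBall) :
    ∃ a, HasExpansion f a := by
  have h : ∀ J (hJ : J ∈ imagUnits), ∃ c : ℕ → ℍ, ∀ z : ℂ, ‖z‖ < 1 →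
      HasSum (fun n => embed hJ (z ^ n) * c n) (f (embed hJ z)) := fun J hJ =>
    exists_hasSum_of_isLittleO hJ fun z hz => hf.isLittleO hJ hz
  choose c hc using h
  have hreal : ∀ J (hJ : J ∈ imagUnits) (x : ℝ), |x| < 1 →
      HasSum (fun n => x ^ n • c J hJ n) (f (x : ℍ)) := by
    intro J hJ x hx
    have h1 := hc J hJ (x : ℂ) (by simpa using hx)
    simpa only [← Complex.ofReal_pow, embed_ofReal, Quaternion.coe_mul_eq_smul] using h1
  refine ⟨c (sliceUnit 0) (sliceUnit_mem 0), fun q hq => ?_⟩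
  obtain ⟨J, hJ, z, rfl⟩ := exists_embed_eq q
  -- All slices share the real interval, which forces their coefficients to agree.
  rw [coeff_unique_of_hasSum (hreal _ (sliceUnit_mem 0)) (hreal J hJ)]
  simpa using hc J hJ z (by simpa using hq)

/-! ### The extremal functions -/

theorem hasExpansion_one_sub_mul (u : ℍ) :
    HasExpansion (fun p => 1 - p * u) fun n => if n = 0 then 1 else if n = 1 then -u else 0 := by
  intro q _
  have h : HasSum (fun n => q ^ n * if n = 0 then 1 else if n = 1 then -u else 0) _ :=
    hasSum_sum_of_ne_finset_zero (s := Finset.range 2) fun n hn => by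
      have h0 : n ≠ 0 := by rintro rfl; simp at hn
      have h1 : n ≠ 1 := by rintro rfl; simp at hn
      simp [h0, h1]
  convert h using 1
  simp [Finset.sum_range_succ, sub_eq_add_neg]

theorem hasExpansion_of_forall_eq (hf : HasExpansion f a) (h : ∀ q : ℍ, ‖q‖ < 1 → g q = f q) :
    HasExpansion g a := fun q hq => h q hq ▸ hf q hq

theorem regConj_one_sub_mul (u q : ℍ) : regConj (fun p => 1 - p * u) q = 1 - q * star u := by
  rw [regConj, (hasExpansion_one_sub_mul u).coeff_eq,
    tsum_eq_sum (s := Finset.range 2) fun n hn => by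
      have h0 : n ≠ 0 := by rintro rfl; simp at hn
      have h1 : n ≠ 1 := by rintro rfl; simp at hn
      simp [h0, h1]]
  simp [Finset.sum_range_succ, sub_eq_add_neg]

theorem symmetrization_one_sub_mul (u q : ℍ) :
    symmetrization (fun p => 1 - p * u) q = 1 - q * (u + star u) + q ^ 2 * (u * star u) := by
  have h : regConj (fun p => 1 - p * u) = fun q => 1 - q * star u :=
    funext (regConj_one_sub_mul u)
  rw [symmetrization, h, starMul, (hasExpansion_one_sub_mul u).coeff_eq,
    (hasExpansion_one_sub_mul (star u)).coeff_eq,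
    tsum_eq_sum (s := Finset.range 3) fun n hn => ?_]
  · simp [Finset.sum_range_succ]
    noncomm_ring
  · simp only [Finset.mem_range, not_lt] at hn
    rw [Finset.sum_eq_zero, mul_zero]
    intro k _
    by_cases h0 : k = 0
    · simp [h0, show n ≠ 0 by omega, show n ≠ 1 by omega]
    · by_cases h1 : k = 1
      · simp [h1, show n - 1 ≠ 0 by omega, show n - 1 ≠ 1 by omega]
      · simp [h0, h1]

theorem mul_star_of_norm_one {u : ℍ} (hu : ‖u‖ = 1) : u * star u = 1 := by
  rw [Quaternion.self_mul_star, Quaternion.normSq_eq_norm_mul_self, hu]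
  simp

/-- The geometric series `S = ∑ qⁿ uⁿ` satisfies `S = 1 + q S u`. Together with `u * star u = 1` and
the reality of `u + star u`, this gives `f^s S = f^c` for `f = 1 - q u`. -/
theorem hasExpansion_regRecip {u : ℍ} (hu : ‖u‖ = 1) :
    HasExpansion (regRecip fun p => 1 - p * u) fun n => u ^ n := by
  have hconv : ConvergesOnBall fun n => u ^ n := by
    intro r h0 h1
    simpa [hu] using summable_geometric_of_lt_one h0 h1
  refine hasExpansion_of_forall_eq hconv.hasExpansion fun q hq => ?_
  have hsum := hconv.hasSum hq
  set S := ∑' n, q ^ n * u ^ n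
  have hS : S = 1 + q * S * u := by
    have h1 := (hasSum_nat_add_iff' 1).2 hsum
    have h2 := (hsum.mul_left q).mul_right u
    have h3 : (fun n => q ^ (n + 1) * u ^ (n + 1)) = fun n => q * (q ^ n * u ^ n) * u := by
      funext n
      rw [pow_succ', pow_succ]
      noncomm_ring
    rw [h3] at h1
    have h4 := h1.unique h2
    simp only [Finset.sum_range_one, pow_zero, mul_one] at h4
    rw [← h4]
    abel
  have huu := mul_star_of_norm_one hu
  have e1 : q * S * u = S - 1 := by rw [eq_sub_iff_add_eq, add_comm, ← hS]
  have e2 : q ^ 2 * S = q * S * star u - q * star u := by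
    calc q ^ 2 * S = q * (q * S * u) * star u := by
          rw [mul_assoc q, mul_assoc (q * S), huu]; noncomm_ring
      _ = _ := by rw [e1]; noncomm_ring
  obtain ⟨t, ht⟩ : ∃ t : ℝ, u + star u = (t : ℍ) := ⟨_, Quaternion.self_add_star' u⟩
  have e3 : q * (u + star u) * S = q * S * (u + star u) := by
    rw [ht, mul_assoc, mul_assoc, Quaternion.coe_commutes t S]
  have key : (1 - q * (u + star u) + q ^ 2 * (u * star u)) * S = 1 - q * star u := by
    rw [huu, mul_one, add_mul, sub_mul, one_mul, e2, e3, mul_add, e1]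
    abel
  rw [regRecip, symmetrization_one_sub_mul, regConj_one_sub_mul, ← key, inv_mul_cancel_left₀]
  intro h0
  rw [h0, zero_mul, eq_comm, sub_eq_zero] at key
  have := congrArg norm key
  rw [norm_one, norm_mul, norm_star, hu, mul_one] at this
  exact hq.ne this.symm

theorem norm_natCast_add_one (n : ℕ) : ‖(n : ℍ) + 1‖ = (n : ℝ) + 1 := by
  have h : (n : ℍ) + 1 = (((n : ℝ) + 1 : ℝ) : ℍ) := by
    rw [Quaternion.coe_add, Quaternion.coe_natCast, Quaternion.coe_one]
  rw [h, Quaternion.norm_coe, Real.norm_of_nonneg (by positivity)]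

theorem hasSum_koebe {u : ℍ} (hu : ‖u‖ = 1) {q : ℍ} (hq : ‖q‖ < 1) :
    HasSum (fun n : ℕ => q ^ (n + 1) * (((n : ℍ) + 1) * u ^ n)) (koebe u q) := by
  have hc := (hasExpansion_regRecip hu).coeff_eq
  have hconv : ConvergesOnBall fun n => ((n : ℍ) + 1) * u ^ n := by
    intro r h0 h1
    refine (summable_succ_mul_geometric h0 h1).congr fun n => ?_
    rw [norm_mul, norm_natCast_add_one, norm_pow, hu]
    ring
  have h := (hconv.hasSum hq).mul_left q
  have e : starMul (regRecip fun p => 1 - p * u) (regRecip fun p => 1 - p * u) q =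
      ∑' n : ℕ, q ^ n * (((n : ℍ) + 1) * u ^ n) := by
    rw [starMul, hc]
    refine tsum_congr fun n => ?_
    congr 1
    rw [Finset.sum_congr rfl fun k hk => ?_, Finset.sum_const, Finset.card_range, nsmul_eq_mul,
      Nat.cast_succ]
    rw [← pow_add, Nat.add_sub_cancel' (by simpa [Nat.lt_succ_iff] using hk)]
  rw [koebe, e]
  simpa only [pow_succ', mul_assoc] using h


/-! ### Formal products and their evaluation -/

variable {c d : ℕ → ℍ}

/-- The sum of the series `∑ qⁿ aₙ`. -/
def seriesSum (a : ℕ → ℍ) (q : ℍ) : ℍ := ∑' n, q ^ n * a n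

/-- The coefficients of the formal product of two power series. -/
def cauchyProd (a b : ℕ → ℍ) (n : ℕ) : ℍ := ∑ p ∈ Finset.HasAntidiagonal.antidiagonal n, a p.1 * b p.2

/-- Power series over the noncommutative ring `ℍ`, with a central variable, supply associativity and
inverses for the regular product. -/
theorem cauchyProd_eq_coeff_mul (a b : ℕ → ℍ) (n : ℕ) :
    cauchyProd a b n = PowerSeries.coeff n (PowerSeries.mk a * PowerSeries.mk b) := by
  simp [cauchyProd, PowerSeries.coeff_mul]

theorem mk_cauchyProd (a b : ℕ → ℍ) :
    PowerSeries.mk (cauchyProd a b) = PowerSeries.mk a * PowerSeries.mk b := by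
  ext1 n
  rw [← cauchyProd_eq_coeff_mul, PowerSeries.coeff_mk]

theorem cauchyProd_assoc (a b c : ℕ → ℍ) :
    cauchyProd (cauchyProd a b) c = cauchyProd a (cauchyProd b c) := by
  funext n
  rw [cauchyProd_eq_coeff_mul, cauchyProd_eq_coeff_mul, mk_cauchyProd, mk_cauchyProd, mul_assoc]

theorem ConvergesOnBall.star (ha : ConvergesOnBall a) : ConvergesOnBall fun n => star (a n) := by
  simpa [ConvergesOnBall] using ha

theorem ConvergesOnBall.cauchyProd (ha : ConvergesOnBall a) (hb : ConvergesOnBall b) :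
    ConvergesOnBall (cauchyProd a b) := by
  intro r h0 h1
  have h := summable_norm_sum_mul_antidiagonal_of_summable_norm
    (f := fun n => r ^ n * ‖a n‖) (g := fun n => r ^ n * ‖b n‖)
    (ha r h0 h1).norm (hb r h0 h1).norm
  refine Summable.of_nonneg_of_le (fun n => by positivity) (fun n => ?_) h
  rw [Real.norm_of_nonneg (Finset.sum_nonneg fun p _ => by positivity)]
  calc r ^ n * ‖SliceRegular.cauchyProd a b n‖
      ≤ r ^ n * ∑ p ∈ Finset.HasAntidiagonal.antidiagonal n, ‖a p.1 * b p.2‖ := by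
        gcongr
        exact norm_sum_le _ _
    _ = _ := by
        rw [Finset.mul_sum]
        refine Finset.sum_congr rfl fun p hp => ?_
        rw [← Finset.HasAntidiagonal.mem_antidiagonal.1 hp, norm_mul, pow_add]
        ring

/-- Evaluation of a formal product. -/
theorem seriesSum_cauchyProd (ha : ConvergesOnBall a) (hb : ConvergesOnBall b) {q : ℍ}
    (hq : ‖q‖ < 1) :
    seriesSum (cauchyProd a b) q = ∑' m, q ^ m * (seriesSum a q * b m) := by
  have hsum : Summable fun p : ℕ × ℕ => q ^ p.2 * (q ^ p.1 * a p.1 * b p.2) := by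
    refine Summable.of_norm ?_
    have h := Summable.mul_of_nonneg (ha ‖q‖ (norm_nonneg q) hq) (hb ‖q‖ (norm_nonneg q) hq)
      (fun n => by positivity) (fun n => by positivity)
    refine h.congr fun p => ?_
    simp only [norm_mul, norm_pow]
    ring
  have h1 : HasSum (fun n => q ^ n * cauchyProd a b n)
      (∑' p : ℕ × ℕ, q ^ p.2 * (q ^ p.1 * a p.1 * b p.2)) := by
    have h := (Finset.HasAntidiagonal.sigmaAntidiagonalEquivProd.hasSum_iff.2 hsum.hasSum).sigma
      fun n => hasSum_fintype _
    convert h using 2 with n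
    rw [cauchyProd, Finset.mul_sum, ← Finset.sum_coe_sort]
    refine Finset.sum_congr rfl fun p _ => ?_
    have hp := Finset.HasAntidiagonal.mem_antidiagonal.1 p.2
    simp only [Function.comp, Finset.HasAntidiagonal.sigmaAntidiagonalEquivProd_apply]
    have hpow : q ^ n = q ^ p.1.2 * q ^ p.1.1 := by rw [← pow_add, add_comm, hp]
    rw [hpow]
    simp only [mul_assoc]
  have h2 : HasSum (fun m => q ^ m * (seriesSum a q * b m))
      (∑' p : ℕ × ℕ, q ^ p.2 * (q ^ p.1 * a p.1 * b p.2)) := by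
    have h := (Equiv.prodComm ℕ ℕ).hasSum_iff.2 hsum.hasSum
    exact h.prod_fiberwise fun m => ((ha.hasSum hq).mul_right (b m)).mul_left (q ^ m)
  rw [seriesSum, h1.tsum_eq, h2.tsum_eq]

/-- Where the left factor does not vanish, a regular product is a pointwise product with a rotated
argument. -/
theorem seriesSum_cauchyProd_of_ne_zero (ha : ConvergesOnBall a) (hb : ConvergesOnBall b) {q : ℍ}
    (hq : ‖q‖ < 1) (h : seriesSum a q ≠ 0) :
    seriesSum (cauchyProd a b) q =
      seriesSum a q * seriesSum b ((seriesSum a q)⁻¹ * q * seriesSum a q) := by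
  rw [seriesSum_cauchyProd ha hb hq]
  set B := seriesSum a q
  have hT : ‖B⁻¹ * q * B‖ < 1 := by
    rw [norm_mul, norm_mul, norm_inv, mul_comm, ← mul_assoc,
      mul_inv_cancel₀ (norm_ne_zero_iff.2 h), one_mul]
    exact hq
  rw [seriesSum, ← (hb.summable_norm hT).of_norm.tsum_mul_left]
  refine tsum_congr fun m => ?_
  have hpow : (B⁻¹ * q * B) ^ m = B⁻¹ * q ^ m * B := by
    induction m with
    | zero => simp [h]
    | succ m ih =>
      rw [pow_succ, ih, pow_succ]
      simp only [mul_assoc]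
      rw [mul_inv_cancel_left₀ h]
  rw [hpow]
  simp only [mul_assoc]
  rw [mul_inv_cancel_left₀ h]

/-! ### Zeros of the regular conjugate -/

theorem star_imagUnits (hI : I ∈ imagUnits) : star I = -I := by
  obtain ⟨h0, -⟩ := imagUnits_components hI
  ext <;> simp [h0]

/-- On a sphere `x + y 𝕊` the sum of a power series is affine in the imaginary unit. -/
theorem exists_sphere_repr (ha : ConvergesOnBall a) {z : ℂ} (hz : ‖z‖ < 1) :
    ∃ β γ : ℍ, ∀ (J : ℍ) (hJ : J ∈ imagUnits), seriesSum a (embed hJ z) = β + J * γ ∧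
      seriesSum (fun n => star (a n)) (embed hJ z) = star β + J * star γ := by
  have hb := ha ‖z‖ (norm_nonneg z) hz
  have hre : Summable fun n => (z ^ n).re • a n :=
    Summable.of_norm_bounded hb fun n => by
      rw [norm_smul, ← norm_pow]
      gcongr
      exact Complex.abs_re_le_norm _
  have him : Summable fun n => (z ^ n).im • a n :=
    Summable.of_norm_bounded hb fun n => by
      rw [norm_smul, ← norm_pow]
      gcongr
      exact Complex.abs_im_le_norm _
  have hpow : ∀ (J : ℍ) (hJ : J ∈ imagUnits) (n : ℕ) (w : ℍ),
      embed hJ z ^ n * w = (z ^ n).re • w + J * ((z ^ n).im • w) := by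
    intro J hJ n w
    rw [← map_pow, embed_apply, slicePoint, add_mul, Quaternion.coe_mul_eq_smul, smul_mul_assoc,
      mul_smul_comm]
  refine ⟨∑' n, (z ^ n).re • a n, ∑' n, (z ^ n).im • a n, fun J hJ => ⟨?_, ?_⟩⟩
  · have h := hre.hasSum.add (him.hasSum.mul_left J)
    rw [seriesSum, ← h.tsum_eq]
    exact tsum_congr fun n => hpow J hJ n _
  · have h := hre.hasSum.star.add (him.hasSum.star.mul_left J)
    rw [seriesSum, ← h.tsum_eq]
    refine tsum_congr fun n => ?_
    rw [hpow J hJ n, Quaternion.star_smul, Quaternion.star_smul]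

/-- The regular conjugate of a function without zeros in the ball has no zeros there. -/
theorem seriesSum_star_ne_zero (ha : ConvergesOnBall a)
    (h : ∀ q : ℍ, ‖q‖ < 1 → seriesSum a q ≠ 0) {q : ℍ} (hq : ‖q‖ < 1) :
    seriesSum (fun n => star (a n)) q ≠ 0 := by
  obtain ⟨I, hI, z, rfl⟩ := exists_embed_eq q
  rw [norm_embed] at hq
  obtain ⟨β, γ, hβγ⟩ := exists_sphere_repr ha hq
  rw [(hβγ I hI).2]
  intro h0
  have h1 : β = γ * I := by
    have := congrArg star h0
    rw [star_add, star_mul, star_star, star_star, star_zero, star_imagUnits hI, mul_neg,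
      add_neg_eq_zero] at this
    exact this
  by_cases hγ : γ = 0
  · refine h (embed hI z) (by simpa using hq) ?_
    rw [(hβγ I hI).1, h1, hγ]
    simp
  · have hJ : -(γ * I * γ⁻¹) ∈ imagUnits := by
      change (-(γ * I * γ⁻¹)) ^ 2 = -1
      rw [neg_sq, sq]
      calc γ * I * γ⁻¹ * (γ * I * γ⁻¹) = γ * I * (γ⁻¹ * γ) * I * γ⁻¹ := by noncomm_ring
        _ = γ * (I * I) * γ⁻¹ := by rw [inv_mul_cancel₀ hγ]; noncomm_ring
        _ = -1 := by
          rw [imagUnits_mul_self hI, mul_neg_one, neg_mul, mul_inv_cancel₀ hγ]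
    refine h (embed hJ z) (by simpa using hq) ?_
    rw [(hβγ _ hJ).1, h1, neg_mul, mul_assoc (γ * I), inv_mul_cancel₀ hγ, mul_one, add_neg_cancel]

/-! ### Regular quotients with positive real part -/

/-- The coefficients of the symmetrization are real. -/
theorem cauchyProd_star_self_eq_re (a : ℕ → ℍ) (n : ℕ) :
    cauchyProd (fun k => star (a k)) a n = ((cauchyProd (fun k => star (a k)) a n).re : ℍ) := by
  rw [← Quaternion.star_eq_self, cauchyProd, star_sum, ← Finset.Nat.sum_antidiagonal_swap]
  simp

theorem exists_cauchyProd_eq (ha0 : a 0 = 1) (d : ℕ → ℍ) : ∃ p, cauchyProd a p = d := by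
  set P := PowerSeries.invOfUnit (PowerSeries.mk a) 1 * PowerSeries.mk d
  refine ⟨fun n => PowerSeries.coeff n P, ?_⟩
  have hP : PowerSeries.mk (fun n => PowerSeries.coeff n P) = P := by
    ext1 n
    simp
  funext n
  rw [cauchyProd_eq_coeff_mul, hP, ← mul_assoc, PowerSeries.mul_invOfUnit _ _ (by
    rw [← PowerSeries.coeff_zero_eq_constantCoeff_apply]; simp [ha0]), one_mul,
    PowerSeries.coeff_mk]

theorem hasSum_planePart (hI : I ∈ imagUnits) (ha : ConvergesOnBall a) {z : ℂ} (hz : ‖z‖ < 1) :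
    HasSum (fun n => z ^ n * planePart I (a n)) (planePart I (seriesSum a (embed hI z))) := by
  have h := (planePart I).hasSum (ha.hasSum (q := embed hI z) (by simpa using hz))
  have e : ∀ n, planePart I (embed hI z ^ n * a n) = z ^ n * planePart I (a n) := fun n => by
    rw [← map_pow, planePart_embed_mul]
  simp only [e] at h
  exact h

/-- The plane parts of a regular quotient `a⁻* * d` are holomorphic functions with positive real
part, provided that the pointwise quotient has positive real part. -/
theorem exists_hasSum_planePart_quotient (ha : ConvergesOnBall a) (hd : ConvergesOnBall d)
    (ha0 : a 0 = 1) (hne : ∀ q : ℍ, ‖q‖ < 1 → seriesSum a q ≠ 0)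
    (hre : ∀ q : ℍ, ‖q‖ < 1 → 0 < ((seriesSum a q)⁻¹ * seriesSum d q).re)
    {p : ℕ → ℍ} (hp : cauchyProd a p = d) (hI : I ∈ imagUnits) :
    ∃ F : ℂ → ℂ, (∀ z : ℂ, ‖z‖ < 1 → HasSum (fun n => z ^ n * planePart I (p n)) (F z)) ∧
      ∀ z : ℂ, ‖z‖ < 1 → 0 < (F z).re := by
  -- The conjugate multiplies on the left, so that associativity turns `a * p = d` into `s * p = e`,
  -- and both `s` and `e` are evaluated at the same rotated point.
  set s := cauchyProd (fun k => star (a k)) a with hs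
  set e := cauchyProd (fun k => star (a k)) d with he
  have hsconv : ConvergesOnBall s := ha.star.cauchyProd ha
  have heconv : ConvergesOnBall e := ha.star.cauchyProd hd
  have hsreal : ∀ n, s n = ((s n).re : ℍ) := cauchyProd_star_self_eq_re a
  have hsp : cauchyProd s p = e := by rw [hs, cauchyProd_assoc, hp]
  have hplane : ∀ n, planePart I (s n) = ((s n).re : ℂ) := fun n => by
    conv_lhs => rw [hsreal n, ← embed_ofReal hI, planePart_embed]
  set σ : ℂ → ℂ := fun z => planePart I (seriesSum s (embed hI z)) with hσ
  have hσsum : ∀ z : ℂ, ‖z‖ < 1 → HasSum (fun n => z ^ n * ((s n).re : ℂ)) (σ z) := by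
    intro z hz
    simpa only [hplane] using hasSum_planePart hI hsconv hz
  have hσeq : ∀ z : ℂ, ‖z‖ < 1 → embed hI (σ z) = seriesSum s (embed hI z) := by
    intro z hz
    have h := (hσsum z hz).map (embed hI) (continuous_embed hI)
    rw [seriesSum, ← h.tsum_eq]
    refine tsum_congr fun n => ?_
    rw [Function.comp, map_mul, map_pow, embed_ofReal, ← hsreal]
  have hquot : ∀ q : ℍ, ‖q‖ < 1 → seriesSum s q ≠ 0 ∧
      0 < ((seriesSum s q)⁻¹ * seriesSum e q).re := by
    intro q hq
    have h0 := seriesSum_star_ne_zero ha hne hq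
    have h1 := seriesSum_cauchyProd_of_ne_zero ha.star ha hq h0
    have h2 := seriesSum_cauchyProd_of_ne_zero ha.star hd hq h0
    set B := seriesSum (fun k => star (a k)) q
    have hT : ‖B⁻¹ * q * B‖ < 1 := by
      rw [norm_mul, norm_mul, norm_inv, mul_comm, ← mul_assoc,
        mul_inv_cancel₀ (norm_ne_zero_iff.2 h0), one_mul]
      exact hq
    rw [h1, h2, mul_inv_rev, mul_assoc _ B⁻¹, inv_mul_cancel_left₀ h0]
    exact ⟨mul_ne_zero h0 (hne _ hT), hre _ hT⟩
  have hσne : ∀ z : ℂ, ‖z‖ < 1 → σ z ≠ 0 := by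
    intro z hz h
    refine (hquot (embed hI z) (by simpa using hz)).1 ?_
    rw [← hσeq z hz, h, map_zero]
  set G : ℂ → ℂ := fun z => planePart I (seriesSum e (embed hI z)) with hG
  have hGsum : ∀ z : ℂ, ‖z‖ < 1 → HasSum (fun n => z ^ n * planePart I (e n)) (G z) :=
    fun z hz => hasSum_planePart hI heconv hz
  set F : ℂ → ℂ := fun z => G z / σ z with hF
  have hFd : DifferentiableOn ℂ F (Metric.ball 0 1) :=
    (Complex.differentiableOn_of_hasSum hGsum).div (Complex.differentiableOn_of_hasSum hσsum)
      fun z hz => hσne z (by simpa using hz)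
  obtain ⟨c, hc⟩ := Complex.hasSum_coeff_of_differentiableOn hFd
  have hprod : ∀ z : ℂ, ‖z‖ < 1 → HasSum
      (fun n => z ^ n * ∑ k ∈ Finset.HasAntidiagonal.antidiagonal n, ((s k.1).re : ℂ) * c k.2) (G z) := by
    intro z hz
    have h1 := hσsum z hz
    have h2 := hc z hz
    have h3 := (summable_norm_sum_mul_antidiagonal_of_summable_norm
      h1.summable.norm h2.summable.norm).of_norm.hasSum
    rw [← tsum_mul_tsum_eq_tsum_sum_antidiagonal_of_summable_norm h1.summable.norm
      h2.summable.norm, h1.tsum_eq, h2.tsum_eq, hF, mul_div_cancel₀ _ (hσne z hz)] at h3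
    have e1 : ∀ n, z ^ n * ∑ k ∈ Finset.HasAntidiagonal.antidiagonal n, ((s k.1).re : ℂ) * c k.2 =
        ∑ k ∈ Finset.HasAntidiagonal.antidiagonal n, z ^ k.1 * ((s k.1).re : ℂ) * (z ^ k.2 * c k.2) := by
      intro n
      rw [Finset.mul_sum]
      refine Finset.sum_congr rfl fun k hk => ?_
      rw [← Finset.HasAntidiagonal.mem_antidiagonal.1 hk, pow_add]
      ring
    simpa only [e1] using h3
  have hcoeff : (fun n => ∑ k ∈ Finset.HasAntidiagonal.antidiagonal n, ((s k.1).re : ℂ) * c k.2) =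
      fun n => planePart I (e n) :=
    coeff_unique_of_hasSum (F := fun x : ℝ => G x)
      (fun x hx => by
        simpa only [← Complex.ofReal_pow, ← Complex.real_smul] using
          hprod x (by simpa using hx))
      (fun x hx => by
        simpa only [← Complex.ofReal_pow, ← Complex.real_smul] using
          hGsum x (by simpa using hx))
  have hmk : PowerSeries.mk (fun n => ((s n).re : ℂ)) * PowerSeries.mk c =
      PowerSeries.mk (fun n => ((s n).re : ℂ)) * PowerSeries.mk fun n => planePart I (p n) := by
    ext n
    simp only [PowerSeries.coeff_mul, PowerSeries.coeff_mk]
    rw [congrFun hcoeff n, ← hsp, cauchyProd, map_sum]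
    refine Finset.sum_congr rfl fun k _ => ?_
    rw [hsreal k.1, ← embed_ofReal hI, planePart_embed_mul, embed_ofReal, ← hsreal]
  have hs0 : PowerSeries.mk (fun n => ((s n).re : ℂ)) ≠ 0 := by
    intro h
    have := congrArg (PowerSeries.coeff 0) h
    simp [hs, cauchyProd, ha0] at this
  -- The real coefficients of `s` pass through the projection, so `c` and the projected `p` have the
  -- same product with `s`; it cancels in `ℂ⟦X⟧` since `s 0 = 1`.
  have hcp : c = fun n => planePart I (p n) := by
    have h := mul_left_cancel₀ hs0 hmk
    funext n
    simpa using congrArg (PowerSeries.coeff n) h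
  refine ⟨F, fun z hz => by simpa only [hcp] using hc z hz, fun z hz => ?_⟩
  have h := (hquot (embed hI z) (by simpa using hz)).2
  rw [← hσeq z hz, ← map_inv₀, ← planePart_re I, planePart_embed_mul] at h
  simpa only [hF, div_eq_inv_mul] using h

/-- The Carathéodory bound for regular quotients. -/
theorem norm_quotient_coeff_le_two (ha : ConvergesOnBall a) (hd : ConvergesOnBall d)
    (ha0 : a 0 = 1) (hne : ∀ q : ℍ, ‖q‖ < 1 → seriesSum a q ≠ 0)
    (hre : ∀ q : ℍ, ‖q‖ < 1 → 0 < ((seriesSum a q)⁻¹ * seriesSum d q).re)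
    {p : ℕ → ℍ} (hp : cauchyProd a p = d) (hp0 : p 0 = 1) :
    (∀ n, 0 < n → ‖p n‖ ≤ 2) ∧
      (‖p 1‖ = 2 → ∃ u : ℍ, ‖u‖ = 1 ∧ ∀ n, p (n + 1) = 2 * u ^ (n + 1)) := by
  have h0 : ∀ I ∈ imagUnits, planePart I (p 0) = 1 := by
    intro I hI
    have := planePart_embed hI 1
    rwa [map_one, ← hp0] at this
  constructor
  · intro n hn
    obtain ⟨I, hI, z, hz⟩ := exists_embed_eq (p n)
    obtain ⟨F, hF, hFre⟩ := exists_hasSum_planePart_quotient ha hd ha0 hne hre hp hI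
    have h := Complex.norm_coeff_le_two hF (h0 I hI) hFre n hn
    rwa [← hz, planePart_embed, ← norm_embed hI, hz] at h
  · intro h1
    obtain ⟨I, hI, z, hz⟩ := exists_embed_eq (p 1)
    obtain ⟨F, hF, hFre⟩ := exists_hasSum_planePart_quotient ha hd ha0 hne hre hp hI
    have hz1 : planePart I (p 1) = z := by rw [← hz, planePart_embed]
    have hznorm : ‖z‖ = 2 := by rw [← norm_embed hI, hz, h1]
    have h := (Complex.norm_coeff_one_le_two hF (h0 I hI) hFre).2 (by rw [hz1, hznorm])
    rw [hz1] at h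
    refine ⟨embed hI (z / 2), by simp [hznorm], fun n => ?_⟩
    -- The plane part already has norm `2`, and the bound on a slice through `p (n + 1)` allows no
    -- more. So `p (n + 1)` lies in the plane of `I`.
    have hle : ‖p (n + 1)‖ ≤ ‖planePart I (p (n + 1))‖ := by
      obtain ⟨J, hJ, w, hw⟩ := exists_embed_eq (p (n + 1))
      obtain ⟨F', hF', hFre'⟩ := exists_hasSum_planePart_quotient ha hd ha0 hne hre hp hJ
      have h2 := Complex.norm_coeff_le_two hF' (h0 J hJ) hFre' (n + 1) n.succ_pos
      rw [← hw, planePart_embed, ← norm_embed hJ, hw] at h2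
      refine h2.trans_eq ?_
      rw [h n]
      simp [hznorm]
    rw [eq_embed_of_norm_planePart hI hle, h n, map_mul, map_pow, map_ofNat]


/-! ### The coefficient recursion -/

theorem sum_range_add_one_mul_two (m : ℕ) :
    ∑ i ∈ Finset.range m, ((i : ℝ) + 1) * 2 = m * (m + 1) := by
  induction m with
  | zero => simp
  | succ m ih => rw [Finset.sum_range_succ, ih]; push_cast; ring

/-- The growth estimate given by the recursion `n a_{n+1} = ∑_{i<n} a_{i+1} p_{n-i}`. -/
theorem norm_le_of_recursion {a p : ℕ → ℍ} (ha : a 1 = 1)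
    (hrec : ∀ n : ℕ, (n : ℍ) * a (n + 1) = ∑ i ∈ Finset.range n, a (i + 1) * p (n - i))
    (hp : ∀ n, 0 < n → ‖p n‖ ≤ 2) (n : ℕ) : ‖a (n + 1)‖ ≤ n + 1 := by
  induction n using Nat.strong_induction_on with
  | _ n ih =>
    rcases n.eq_zero_or_pos with rfl | hn
    · simp [ha]
    · have hn' : (0 : ℝ) < n := by exact_mod_cast hn
      have h := congrArg norm (hrec n)
      rw [norm_mul, ← Quaternion.coe_natCast, Quaternion.norm_coe, Real.norm_natCast] at h
      have h1 : (n : ℝ) * ‖a (n + 1)‖ ≤ ∑ i ∈ Finset.range n, ((i : ℝ) + 1) * 2 := by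
        rw [h]
        refine (norm_sum_le _ _).trans (Finset.sum_le_sum fun i hi => ?_)
        have hi' := Finset.mem_range.1 hi
        rw [norm_mul]
        exact mul_le_mul (ih i hi') (hp _ (by omega)) (norm_nonneg _) (by positivity)
      rw [sum_range_add_one_mul_two] at h1
      exact le_of_mul_le_mul_left h1 hn'

/-- Isolating the last term of the recursion gives `(n+1)(n+2) ≤ n(n+1) + (n+1)‖p 1‖`, hence `‖p 1‖
≥ 2`. -/
theorem norm_one_of_recursion {a p : ℕ → ℍ} (ha : a 1 = 1)
    (hrec : ∀ n : ℕ, (n : ℍ) * a (n + 1) = ∑ i ∈ Finset.range n, a (i + 1) * p (n - i))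
    (hp : ∀ n, 0 < n → ‖p n‖ ≤ 2) {n : ℕ} (hn : ‖a (n + 2)‖ = n + 2) : ‖p 1‖ = 2 := by
  refine le_antisymm (hp 1 one_pos) ?_
  have h := congrArg norm (hrec (n + 1))
  rw [norm_mul, ← Quaternion.coe_natCast, Quaternion.norm_coe, Real.norm_natCast, hn,
    Finset.sum_range_succ, Nat.add_sub_cancel_left] at h
  have h1 : ‖∑ i ∈ Finset.range n, a (i + 1) * p (n + 1 - i)‖ ≤ n * (n + 1) := by
    rw [← sum_range_add_one_mul_two]
    refine (norm_sum_le _ _).trans (Finset.sum_le_sum fun i hi => ?_)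
    have hi' := Finset.mem_range.1 hi
    rw [norm_mul]
    exact mul_le_mul (norm_le_of_recursion ha hrec hp i) (hp _ (by omega)) (norm_nonneg _)
      (by positivity)
  have h3 := h.le.trans (norm_add_le _ _)
  rw [norm_mul] at h3
  have h4 : ‖a (n + 1)‖ * ‖p 1‖ ≤ (n + 1) * ‖p 1‖ := by
    gcongr
    exact norm_le_of_recursion ha hrec hp n
  push_cast at h3
  have h5 : ((n : ℝ) + 1) * 2 ≤ (n + 1) * ‖p 1‖ := by nlinarith
  exact le_of_mul_le_mul_left h5 (by positivity)

theorem eq_of_recursion {a p : ℕ → ℍ} {u : ℍ} (ha : a 1 = 1)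
    (hrec : ∀ n : ℕ, (n : ℍ) * a (n + 1) = ∑ i ∈ Finset.range n, a (i + 1) * p (n - i))
    (hp : ∀ n, p (n + 1) = 2 * u ^ (n + 1)) (n : ℕ) : a (n + 1) = ((n : ℍ) + 1) * u ^ n := by
  induction n using Nat.strong_induction_on with
  | _ n ih =>
    rcases n.eq_zero_or_pos with rfl | hn
    · simp [ha]
    · have hn' : (n : ℍ) ≠ 0 := by
        rw [← Quaternion.coe_natCast, Ne, ← Quaternion.coe_zero, Quaternion.coe_inj]
        exact_mod_cast hn.ne'
      have h2 : ∀ m : ℕ, ∑ i ∈ Finset.range m, ((i : ℍ) + 1) * 2 = m * (m + 1) := by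
        intro m
        induction m with
        | zero => simp
        | succ m ihm => rw [Finset.sum_range_succ, ihm]; push_cast; noncomm_ring
      refine mul_left_cancel₀ hn' ?_
      rw [hrec n, ← mul_assoc, ← h2, Finset.sum_mul]
      refine Finset.sum_congr rfl fun i hi => ?_
      have hi' := Finset.mem_range.1 hi
      obtain ⟨k, rfl⟩ : ∃ k, n = i + (k + 1) := ⟨n - i - 1, by omega⟩
      rw [ih i hi', Nat.add_sub_cancel_left, hp, pow_add u i, mul_assoc, mul_assoc,
        ← mul_assoc (u ^ i), ← mul_assoc (2 : ℍ), (Commute.ofNat_right (u ^ i) 2).eq]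

/-! ### Starlike functions and the equality case -/

/-- The expansion of a function in `𝒮*` together with that of the regular quotient
`f^{-*} * q f'`. -/
theorem ClassSStar.exists_expansion {f : ℍ → ℍ} (hf : ClassSStar f) :
    HasExpansion f (coeff f) ∧ coeff f 0 = 0 ∧ coeff f 1 = 1 ∧
      ∃ p : ℕ → ℍ,
        (∀ n : ℕ, (n : ℍ) * coeff f (n + 1) =
          ∑ i ∈ Finset.range n, coeff f (i + 1) * p (n - i)) ∧
        (∀ n, 0 < n → ‖p n‖ ≤ 2) ∧
        (‖p 1‖ = 2 → ∃ u : ℍ, ‖u‖ = 1 ∧ ∀ n, p (n + 1) = 2 * u ^ (n + 1)) := by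
  obtain ⟨a, ha⟩ := hf.classS.sliceRegular.exists_hasExpansion
  rw [ha.coeff_eq]
  have hf0 : f 0 = 0 := by
    have : (0 : ℍ) ∈ {q ∈ unitBall | f q = 0} := by rw [hf.classS.zeroSet]; rfl
    exact this.2
  have hfne : ∀ q : ℍ, ‖q‖ < 1 → q ≠ 0 → f q ≠ 0 := by
    intro q hq hq0 h
    have : q ∈ {q ∈ unitBall | f q = 0} := ⟨by simpa [unitBall] using hq, h⟩
    rw [hf.classS.zeroSet] at this
    exact hq0 this
  have ha0 : a 0 = 0 := by rw [← ha.zero, hf0]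
  have hd := ha.sliceDeriv
  have ha1 : a 1 = 1 := by
    have h := hd.zero
    rw [hf.classS.deriv_zero] at h
    simpa using h.symm
  set d : ℕ → ℍ := fun n => ((n : ℍ) + 1) * a (n + 1)
  set b : ℕ → ℍ := fun n => a (n + 1)
  have hdconv : ConvergesOnBall d := hd.convergesOnBall
  have hbconv : ConvergesOnBall b := by
    intro r h0 h1
    refine Summable.of_nonneg_of_le (fun n => by positivity) (fun n => ?_) (hdconv r h0 h1)
    simp only [d, b, norm_mul, norm_natCast_add_one]
    have : 0 ≤ (n : ℝ) * (r ^ n * ‖a (n + 1)‖) := by positivity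
    nlinarith
  have hfb : ∀ q : ℍ, ‖q‖ < 1 → f q = q * seriesSum b q := by
    intro q hq
    have h1 := (hasSum_nat_add_iff' 1).2 (ha q hq)
    have h2 := (hbconv.hasSum hq).mul_left q
    simp only [Finset.sum_range_one, pow_zero, ha0, mul_zero, sub_zero] at h1
    refine h1.unique ?_
    simp only [pow_succ', mul_assoc]
    exact h2
  have hb0 : seriesSum b 0 = 1 := by
    have h := hbconv.hasExpansion.zero
    exact h.trans ha1
  have hd0 : seriesSum d 0 = 1 := by
    have h := hdconv.hasExpansion.zero
    refine h.trans ?_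
    simp [d, ha1]
  have hbne : ∀ q : ℍ, ‖q‖ < 1 → seriesSum b q ≠ 0 := by
    intro q hq h
    by_cases hq0 : q = 0
    · rw [hq0, hb0] at h
      exact one_ne_zero h
    · refine hfne q hq hq0 ?_
      rw [hfb q hq, h, mul_zero]
  -- Since `f = q b`, the factor `q` cancels in `f⁻¹ q f' = b⁻¹ f'`, which also has the value `1` at
  -- the origin.
  have hre : ∀ q : ℍ, ‖q‖ < 1 → 0 < ((seriesSum b q)⁻¹ * seriesSum d q).re := by
    intro q hq
    by_cases hq0 : q = 0
    · rw [hq0, hb0, hd0]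
      simp
    · have h := hf.re_pos q (by simpa [unitBall] using hq) hq0
      rw [hfb q hq, mul_inv_rev, mul_assoc _ q⁻¹ q, inv_mul_cancel₀ hq0, mul_one,
        ← (hd q hq).tsum_eq] at h
      exact h
  obtain ⟨p, hp⟩ := exists_cauchyProd_eq (a := b) ha1 d
  have hrange : ∀ n : ℕ, ∑ i ∈ Finset.range (n + 1), a (i + 1) * p (n - i) =
      ((n : ℍ) + 1) * a (n + 1) := by
    intro n
    have h := congrFun hp n
    rw [cauchyProd, Finset.Nat.sum_antidiagonal_eq_sum_range_succ_mk] at h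
    exact h
  have hp0 : p 0 = 1 := by simpa [ha1] using hrange 0
  refine ⟨ha, ha0, ha1, p, fun n => ?_,
    norm_quotient_coeff_le_two hbconv hdconv ha1 hbne hre hp hp0⟩
  have h := hrange n
  -- The term `i = n` is `a (n + 1)` because `p 0 = 1`; removing it lowers the factor `n + 1` to
  -- `n`.
  rw [Finset.sum_range_succ, Nat.sub_self, hp0, mul_one, add_mul, one_mul] at h
  exact (add_right_cancel h).symm

/-- At `n = 0` the truncated exponent is harmless, as the factor `n` vanishes. -/
theorem hasExpansion_koebe {u : ℍ} (hu : ‖u‖ = 1) :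
    HasExpansion (koebe u) fun n => (n : ℍ) * u ^ (n - 1) := by
  intro q hq
  have h := hasSum_koebe hu hq
  rw [← hasSum_nat_add_iff' 1]
  simpa using h

end SliceRegular

end

theorem theorem4p2 (f : ℍ → ℍ) (hf : SliceRegular.ClassSStar f) :
    (∀ q ∈ SliceRegular.unitBall,
      HasSum (fun n : ℕ => q ^ (n + 2) * SliceRegular.coeff f (n + 2)) (f q - q)) ∧
    (∀ n : ℕ, 2 ≤ n → ‖SliceRegular.coeff f n‖ ≤ (n : ℝ)) ∧
    (∀ n : ℕ, 2 ≤ n →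
      (‖SliceRegular.coeff f n‖ = (n : ℝ) ↔
        ∃ u : ℍ, ‖u‖ = 1 ∧ ∀ q ∈ SliceRegular.unitBall, f q = SliceRegular.koebe u q)) := by
  obtain ⟨hexp, h0, h1, p, hrec, hp, hext⟩ := hf.exists_expansion
  refine ⟨fun q hq => ?_, fun n hn => ?_, fun n hn => ⟨fun h => ?_, ?_⟩⟩
  · have h := (hasSum_nat_add_iff' 2).2 (hexp q (by simpa [SliceRegular.unitBall] using hq))
    simpa [Finset.sum_range_succ, h0, h1] using h
  · obtain ⟨k, rfl⟩ := Nat.exists_eq_add_of_le' (one_le_two.trans hn)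
    simpa using SliceRegular.norm_le_of_recursion h1 hrec hp k
  · obtain ⟨k, rfl⟩ := Nat.exists_eq_add_of_le' hn
    obtain ⟨u, hu, hpu⟩ := hext
      (SliceRegular.norm_one_of_recursion h1 hrec hp (by rw [h]; push_cast; rfl))
    refine ⟨u, hu, fun q hq => ?_⟩
    have hq' : ‖q‖ < 1 := by simpa [SliceRegular.unitBall] using hq
    have h2 := (hasSum_nat_add_iff' 1).2 (hexp q hq')
    simp only [Finset.sum_range_one, h0, mul_zero, sub_zero,
      SliceRegular.eq_of_recursion h1 hrec hpu] at h2
    exact h2.unique (SliceRegular.hasSum_koebe hu hq')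
  · rintro ⟨u, hu, h⟩
    have hk : SliceRegular.HasExpansion f fun n => (n : ℍ) * u ^ (n - 1) :=
      SliceRegular.hasExpansion_of_forall_eq (SliceRegular.hasExpansion_koebe hu)
        fun q hq => h q (by simpa [SliceRegular.unitBall] using hq)
    rw [hk.coeff_eq, norm_mul, norm_pow, hu, ← Quaternion.coe_natCast, Quaternion.norm_coe]
    simp
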